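/- Let $G$ be a countable (discrete) amenable group, i.e. there is a left-invariant mean on $\ell^\infty(G,\mathbb{R})$. A unitary representation $(H_\pi,\pi)$ of $G$ is a homomorphism $\pi$ from $G$ to the unitary group of a complex Hilbert space $H_\pi$. Let $\lambda_G$ be the left regular representation of $G$ on $\ell^2(G)$, $(\lambda_G(g)f)(h)=f(g^{-1}h)$, and let $(H_{\infty\lambda_G},\infty\lambda_G)$ be the Hilbert space direct sum of countably infinitely many copies of it. A representation $(H_\pi,\pi)$ is regarded as a two-sorted structure, with a sort for $H_\pi$ and a sort for the field $\mathbb{C}$. Vector terms are built from vector variables and $0$ by addition, multiplication by scalar terms and the operators $\pi(g)$, $g\in G$; scalar terms are built from scalar variables and rational constants by addition, multiplication, complex conjugation and the inner product of vector terms. Atomic formulas are $r(c)\le p$ and $r(c)\ge p$, where $c$ is a scalar term (for instance $\langle s,t\rangle$), $p$ is a rational number and $r$ is the real part, the imaginary part or the modulus. Quantifier-free (positive) formulas are obtained from atomic ones by conjunctions and disjunctions. An approximation $\varphi'$ of a quantifier-free formula $\varphi$ is obtained by replacing every atomic subformula $r(c)\le p$ by $r(c)\le p+\varepsilon$ and every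 $r(c)\ge p$ by $r(c)\ge p-\varepsilon$, with rational numbers $\varepsilon>0$ that may differ from one occurrence to another. The structure $(H_\pi,+,\langle\cdot,\cdot\rangle,\pi)$ is existentially closed (in approximate semantics) if for every unitary representation $(H_\eta,\eta)$ of $G$ extending $(H_\pi,\pi)$, every finite tuple $\bar v$ of parameters from $H_\pi$ and from $\mathbb{C}$, every quantifier-free formula $\varphi(\bar x,\bar y)$ such that $\exists\bar x\,\varphi(\bar x,\bar v)$ holds in $(H_\eta,\eta)$, and every approximation $\varphi'$ of $\varphi$, the formula $\exists\bar x\,\varphi'(\bar x,\bar v)$ holds in $(H_\pi,\pi)$. Then for every unitary representation $(H_\pi,\pi)$ of $G$ the structure $$(H_\pi\oplus H_{\infty\lambda_G},+,\langle\cdot,\cdot\rangle,\pi\oplus\infty\lambda_G)$$ is existentially closed. In particular, $(H_{\infty\lambda_G},+,\langle\cdot,\cdot\rangle,\infty\lambda_G)$ is existentially closed. -/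

import Mathlib

open scoped ENNReal

universe u v w

noncomputable section

/-- A discrete group is amenable if there is a left-invariant mean on the bounded real-valued
functions on it: a positive, normalized, left-invariant linear functional on `ℓ^∞(G, ℝ)`. -/
def IsAmenableGroup (G : Type u) [Group G] : Prop :=
  ∃ m : lp (fun _ : G => ℝ) ∞ →ₗ[ℝ] ℝ,
    m 1 = 1 ∧
    (∀ f : lp (fun _ : G => ℝ) ∞, (∀ h, 0 ≤ f h) → 0 ≤ m f) ∧
    (∀ (g : G) (f f' : lp (fun _ : G => ℝ) ∞), (∀ h, f' h = f (g⁻¹ * h)) → m f' = m f)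

/-- A unitary representation of `G` on `H`: a homomorphism from `G` to the group of unitary
operators (surjective linear isometries) of `H`. -/
abbrev UnitaryRep (G : Type u) [Group G] (H : Type v) [NormedAddCommGroup H]
    [InnerProductSpace ℂ H] : Type (max u v) :=
  G →* (H ≃ₗᵢ[ℂ] H)

namespace UnitaryRep

/-- The coordinatewise action of a family of linear isometric automorphisms on the Hilbert sum. -/
def lpMap {I : Type v} {E : I → Type w} [∀ i, NormedAddCommGroup (E i)]
    [∀ i, InnerProductSpace ℂ (E i)] (T : ∀ i, E i ≃ₗᵢ[ℂ] E i) : lp E 2 ≃ₗᵢ[ℂ] lp E 2 where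
  toFun f := ⟨fun i => T i (f i), memℓp_gen (by simpa using lp.memℓp f |>.summable (by simp))⟩
  invFun f :=
    ⟨fun i => (T i).symm (f i), memℓp_gen (by simpa using lp.memℓp f |>.summable (by simp))⟩
  map_add' f g := by ext i; simp; rfl
  map_smul' c f := by ext i; simp
  left_inv f := by ext i; simp
  right_inv f := by ext i; simp
  norm_map' f := by
    have h2 : 0 < (2 : ℝ≥0∞).toReal := by simp
    simp [lp.norm_eq_tsum_rpow h2]

/-- The direct sum of a family of unitary representations, on the Hilbert space direct sum. -/
def directSum {G : Type u} [Group G] {I : Type v} {E : I → Type w}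
    [∀ i, NormedAddCommGroup (E i)] [∀ i, InnerProductSpace ℂ (E i)]
    (π : ∀ i, UnitaryRep G (E i)) : UnitaryRep G (lp E 2) where
  toFun g := lpMap fun i => π i g
  map_one' := by ext f i; simp [lpMap]
  map_mul' g h := by ext f i; simp [lpMap]

/-- The direct sum of countably infinitely many copies of a unitary representation. -/
def infiniteSum {G : Type u} [Group G] {H : Type v} [NormedAddCommGroup H]
    [InnerProductSpace ℂ H] (π : UnitaryRep G H) : UnitaryRep G (lp (fun _ : ℕ => H) 2) :=
  directSum fun _ => π

/-- The direct sum of two unitary representations. -/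
def prod {G : Type u} [Group G] {H : Type v} {K : Type w}
    [NormedAddCommGroup H] [InnerProductSpace ℂ H] [NormedAddCommGroup K] [InnerProductSpace ℂ K]
    (π : UnitaryRep G H) (ρ : UnitaryRep G K) : UnitaryRep G (WithLp 2 (H × K)) where
  toFun g := LinearIsometryEquiv.withLpProdCongr 2 (π g) (ρ g)
  map_one' := by ext x; simp [LinearIsometryEquiv.withLpProdCongr]; rfl
  map_mul' g h := by ext x; simp [LinearIsometryEquiv.withLpProdCongr]; rfl

/-- Reindexing of `ℓ²(I)` along a permutation of `I`: the function `f` goes to `f ∘ e`. -/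
def lpReindex {I : Type u} (e : I ≃ I) :
    lp (fun _ : I => ℂ) 2 ≃ₗᵢ[ℂ] lp (fun _ : I => ℂ) 2 where
  toFun f := ⟨fun i => f (e i),
    memℓp_gen ((e.summable_iff (f := fun i => ‖f i‖ ^ (2 : ℝ≥0∞).toReal)).2
      ((lp.memℓp f).summable (by simp)))⟩
  invFun f := ⟨fun i => f (e.symm i),
    memℓp_gen ((e.symm.summable_iff (f := fun i => ‖f i‖ ^ (2 : ℝ≥0∞).toReal)).2
      ((lp.memℓp f).summable (by simp)))⟩
  map_add' f g := by ext i; simp; rfl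
  map_smul' c f := by ext i; simp
  left_inv f := by ext i; simp
  right_inv f := by ext i; simp
  norm_map' f := by
    have h2 : 0 < (2 : ℝ≥0∞).toReal := by simp
    rw [lp.norm_eq_tsum_rpow h2, lp.norm_eq_tsum_rpow h2]
    congr 1
    exact e.tsum_eq fun i => ‖f i‖ ^ (2 : ℝ≥0∞).toReal

/-- The (left) regular representation on `ℓ²(G)`: `(λ(g) f)(h) = f (g⁻¹ h)`. -/
def regular (G : Type u) [Group G] : UnitaryRep G (lp (fun _ : G => ℂ) 2) where
  toFun g := lpReindex (Equiv.mulLeft g⁻¹)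
  map_one' := by ext f i; simp [lpReindex]
  map_mul' g h := by ext f i; simp [lpReindex, mul_assoc]

end UnitaryRep

/-- The two sorts of the language: vectors and complex scalars. -/
inductive HSort : Type
  | vec : HSort
  | scal : HSort

/-- Terms of the two-sorted language of Hilbert spaces with an action of `G`. Here `V` and `S`
are the sets of variables of the sorts of vectors and of scalars. -/
inductive RepTerm (G : Type u) (V S : Type) : HSort → Type u
  | vecVar (x : V) : RepTerm G V S HSort.vec
  | zero : RepTerm G V S HSort.vec
  | vecAdd (s t : RepTerm G V S HSort.vec) : RepTerm G V S HSort.vec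
  | smul (c : RepTerm G V S HSort.scal) (s : RepTerm G V S HSort.vec) : RepTerm G V S HSort.vec
  | act (g : G) (s : RepTerm G V S HSort.vec) : RepTerm G V S HSort.vec
  | scalVar (a : S) : RepTerm G V S HSort.scal
  | const (q : ℚ) : RepTerm G V S HSort.scal
  | scalAdd (c d : RepTerm G V S HSort.scal) : RepTerm G V S HSort.scal
  | mul (c d : RepTerm G V S HSort.scal) : RepTerm G V S HSort.scal
  | conj (c : RepTerm G V S HSort.scal) : RepTerm G V S HSort.scal
  | inner (s t : RepTerm G V S HSort.vec) : RepTerm G V S HSort.scal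

/-- The interpretation of the two sorts in a Hilbert space `H`. -/
abbrev HSort.carrier (H : Type v) : HSort → Type v
  | HSort.vec => H
  | HSort.scal => ULift.{v} ℂ

namespace RepTerm

/-- The value of a term in the structure given by a unitary representation. -/
def eval {G : Type u} [Group G] {H : Type v} [NormedAddCommGroup H] [InnerProductSpace ℂ H]
    (π : UnitaryRep G H) {V S : Type} (x : V → H) (a : S → ℂ) :
    ∀ {σ : HSort}, RepTerm G V S σ → HSort.carrier H σ
  | _, vecVar i => x i
  | _, zero => (0 : H)
  | _, vecAdd s t => (eval π x a s + eval π x a t : H)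
  | _, smul c s => ((eval π x a c).down • eval π x a s : H)
  | _, act g s => π g (eval π x a s)
  | _, scalVar i => ULift.up (a i)
  | _, const q => ULift.up (q : ℂ)
  | _, scalAdd c d => ULift.up ((eval π x a c).down + (eval π x a d).down)
  | _, mul c d => ULift.up ((eval π x a c).down * (eval π x a d).down)
  | _, conj c => ULift.up (starRingEnd ℂ (eval π x a c).down)
  | _, inner s t => ULift.up (Inner.inner ℂ (eval π x a s : H) (eval π x a t : H))

end RepTerm

/-- The three real quantities attached to a complex number that are compared with rationals. -/
inductive RealPart : Type
  | re : RealPart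
  | im : RealPart
  | abs : RealPart

/-- The real part, the imaginary part, or the modulus of a complex number. -/
def RealPart.eval : RealPart → ℂ → ℝ
  | RealPart.re, z => z.re
  | RealPart.im, z => z.im
  | RealPart.abs, z => ‖z‖

/-- Quantifier-free positive formulas: the closure of the atomic formulas `c ≤ p` and `c ≥ p`
(for the real part, the imaginary part or the modulus of a scalar term `c`, and `p` rational)
under conjunction and disjunction. -/
inductive QFFormula (G : Type u) (V S : Type) : Type u
  | le (r : RealPart) (c : RepTerm G V S HSort.scal) (p : ℚ) : QFFormula G V S
  | ge (r : RealPart) (c : RepTerm G V S HSort.scal) (p : ℚ) : QFFormula G V S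
  | and (φ ψ : QFFormula G V S) : QFFormula G V S
  | or (φ ψ : QFFormula G V S) : QFFormula G V S

namespace QFFormula

/-- Satisfaction of a quantifier-free formula in the structure given by a representation. -/
def Realize {G : Type u} [Group G] {H : Type v} [NormedAddCommGroup H] [InnerProductSpace ℂ H]
    (π : UnitaryRep G H) {V S : Type} (x : V → H) (a : S → ℂ) : QFFormula G V S → Prop
  | le r c p => r.eval (c.eval π x a).down ≤ (p : ℝ)
  | ge r c p => (p : ℝ) ≤ r.eval (c.eval π x a).down
  | and φ ψ => Realize π x a φ ∧ Realize π x a ψ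
  | or φ ψ => Realize π x a φ ∨ Realize π x a ψ

/-- `Approx φ φ'` says that `φ'` is an approximation of `φ`: it arises from `φ` by strictly
relaxing the bound in every atomic formula. -/
inductive Approx {G : Type u} {V S : Type} : QFFormula G V S → QFFormula G V S → Prop
  | le (r : RealPart) (c : RepTerm G V S HSort.scal) (p ε : ℚ) (hε : 0 < ε) :
      Approx (QFFormula.le r c p) (QFFormula.le r c (p + ε))
  | ge (r : RealPart) (c : RepTerm G V S HSort.scal) (p ε : ℚ) (hε : 0 < ε) :
      Approx (QFFormula.ge r c p) (QFFormula.ge r c (p - ε))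
  | and {φ φ' ψ ψ' : QFFormula G V S} (hφ : Approx φ φ') (hψ : Approx ψ ψ') :
      Approx (QFFormula.and φ ψ) (QFFormula.and φ' ψ')
  | or {φ φ' ψ ψ' : QFFormula G V S} (hφ : Approx φ φ') (hψ : Approx ψ ψ') :
      Approx (QFFormula.or φ ψ) (QFFormula.or φ' ψ')

end QFFormula

namespace UnitaryRep

/-- The structure `(H, +, ⟨,⟩, π)` is existentially closed in approximate semantics: whenever a
representation `(K, η)` extends `(H, π)`, every existential formula with parameters in `H` (and in
the scalar sort) that holds in `(K, η)` is such that all its approximations hold in `(H, π)`.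
The extension is given by an equivariant linear isometric embedding `ι`. The quantified variables
are those in the left summands, the parameters are plugged in for those in the right summands. -/
def ExistentiallyClosed {G : Type u} [Group G] {H : Type v} [NormedAddCommGroup H]
    [InnerProductSpace ℂ H] (π : UnitaryRep G H) : Prop :=
  ∀ (K : Type w) [NormedAddCommGroup K] [InnerProductSpace ℂ K] [CompleteSpace K]
    (η : UnitaryRep G K) (ι : H →ₗᵢ[ℂ] K) (_ : ∀ g v, ι (π g v) = η g (ι v))
    (m n k l : ℕ) (v : Fin n → H) (b : Fin l → ℂ)
    (φ φ' : QFFormula G (Fin m ⊕ Fin n) (Fin k ⊕ Fin l)),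
    (∃ (x : Fin m → K) (a : Fin k → ℂ),
      φ.Realize η (Sum.elim x fun i => ι (v i)) (Sum.elim a b)) →
    φ.Approx φ' →
    ∃ (x : Fin m → H) (a : Fin k → ℂ), φ'.Realize π (Sum.elim x v) (Sum.elim a b)

end UnitaryRep

end

/-!
Along a filter, convergence of all matrix coefficients `g ↦ ⟪π g yᵢ, yⱼ⟫` of a tuple forces
convergence of every scalar term, so these Gram data decide approximate satisfaction of
quantifier-free formulas. It therefore suffices to approximate the Gram data of a tuple `Y` in an
extension `η` of `σ` by those of tuples in `σ`, keeping the parameters fixed. Write `Y = ι P + Q`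
with `Q` orthogonal to the range of `ι`; then the Gram data of `Y` is the sum of those of `P` and
`Q`, and `Q` vanishes at the parameters. By Fell absorption `λ ⊗ η` is a multiple of `λ`, so for
`ξ ∈ ℓ²(G)` of finite support the Gram data of `Q` multiplied by `⟪λ g ξ, ξ⟫` is realized in
finitely many of the copies of `λ` contained in `σ`. Moving these copies to infinity makes the
vectors weakly null, so that in the limit they do not interact with `P`. Amenability, through
Day's convexity argument and Reiter's condition, provides `ξ` with `⟪λ g ξ, ξ⟫` arbitrarily close
to `1`.
-/

open scoped Topology InnerProductSpace
open Filter

section FiniteSupport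

variable {α E : Type*} [NormedAddCommGroup E]

/-- A finitely supported function regarded as an element of `ℓ^p`, as a linear map. -/
noncomputable def finsuppToLp (𝕜 : Type*) [NormedField 𝕜] [NormedSpace 𝕜 E] (p : ℝ≥0∞) :
    (α →₀ E) →ₗ[𝕜] lp (fun _ : α => E) p where
  toFun f := ⟨fun a => f a, (memℓp_zero f.hasFiniteSupport).of_exponent_ge zero_le⟩
  map_add' _ _ := rfl
  map_smul' _ _ := rfl

theorem finsuppToLp_apply (𝕜 : Type*) [NormedField 𝕜] [NormedSpace 𝕜 E] (p : ℝ≥0∞)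
    (f : α →₀ E) (a : α) : finsuppToLp 𝕜 p f a = f a := rfl

theorem finsuppToLp_single [DecidableEq α] (𝕜 : Type*) [NormedField 𝕜] [NormedSpace 𝕜 E]
    (p : ℝ≥0∞) (a : α) (x : E) :
    finsuppToLp 𝕜 p (Finsupp.single a x) = lp.single p a x := by
  ext b
  simp [finsuppToLp_apply, Finsupp.single_apply, Pi.single_apply, eq_comm]

/-- The finitely supported probability distributions on `α`. -/
def finsuppSimplex (α : Type*) : Set (α →₀ ℝ) :=
  {p | (∀ a, 0 ≤ p a) ∧ (p.sum fun _ t => t) = 1}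

theorem convex_finsuppSimplex : Convex ℝ (finsuppSimplex α) := by
  have total (p : α →₀ ℝ) :
      (p.sum fun _ t => t) = Finsupp.linearCombination ℝ (fun _ => (1 : ℝ)) p := by
    simp [Finsupp.linearCombination_apply]
  rintro p ⟨hp, hp_total⟩ q ⟨hq, hq_total⟩ s t hs ht hst
  rw [total] at hp_total hq_total
  refine ⟨fun a => add_nonneg (mul_nonneg hs (hp a)) (mul_nonneg ht (hq a)), ?_⟩
  rw [total, map_add, map_smul, map_smul, hp_total, hq_total, smul_eq_mul, smul_eq_mul, mul_one,
    mul_one, hst]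

theorem single_one_mem_finsuppSimplex (a : α) : Finsupp.single a 1 ∈ finsuppSimplex α :=
  ⟨fun b => Finsupp.single_nonneg.2 zero_le_one b, Finsupp.sum_single_index rfl⟩

theorem exists_bounded_eq_apply_single [DecidableEq α] (f : lp (fun _ : α => ℝ) 1 →L[ℝ] ℝ) :
    ∃ ψ : lp (fun _ : α => ℝ) ∞, ∀ a, ψ a = f (lp.single 1 a 1) := by
  refine ⟨⟨fun a => f (lp.single 1 a 1), memℓp_infty ⟨‖f‖, ?_⟩⟩, fun _ => rfl⟩
  rintro _ ⟨a, rfl⟩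
  simpa [lp.norm_single] using f.le_opNorm (lp.single 1 a 1)

theorem lp_norm_sq_eq_tsum {E : α → Type*} [∀ a, NormedAddCommGroup (E a)] (f : lp E 2) :
    ‖f‖ ^ 2 = ∑' a, ‖f a‖ ^ 2 := by
  simpa using lp.norm_rpow_eq_tsum (p := 2) (by simp) f

end FiniteSupport

section Amenable

variable {G : Type u} [Group G]

/-- The failure of a finitely supported function `p` on `G` to be invariant under left translation
by the elements `s i`, measured in `ℓ¹`: the family of the functions `h ↦ p (s i⁻¹ * h) - p h`. -/
noncomputable def translateSub {ι : Type*} (s : ι → G) :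
    (G →₀ ℝ) →ₗ[ℝ] ι → lp (fun _ : G => ℝ) 1 :=
  LinearMap.pi fun i => finsuppToLp ℝ 1 ∘ₗ (Finsupp.lmapDomain ℝ ℝ (s i * ·) - LinearMap.id)

theorem translateSub_apply {ι : Type*} (s : ι → G) (p : G →₀ ℝ) (i : ι) (h : G) :
    translateSub s p i h = p ((s i)⁻¹ * h) - p h := by
  have translate : p.mapDomain (s i * ·) h = p ((s i)⁻¹ * h) := by
    simpa using Finsupp.mapDomain_apply (mul_right_injective (s i)) p ((s i)⁻¹ * h)
  simp [translateSub, finsuppToLp_apply, translate]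

theorem translateSub_single [DecidableEq G] {ι : Type*} (s : ι → G) (h : G) (i : ι) :
    translateSub s (Finsupp.single h 1) i = lp.single 1 (s i * h) 1 - lp.single 1 h 1 := by
  simp [translateSub, finsuppToLp_single]

namespace IsAmenableGroup

theorem exists_sum_translate_sub_lt (hG : IsAmenableGroup G) {ι : Type*} [Fintype ι] (s : ι → G)
    (ψ : ι → lp (fun _ : G => ℝ) ∞) {c : ℝ} (hc : 0 < c) :
    ∃ h, ∑ i, (ψ i (s i * h) - ψ i h) < c := by
  obtain ⟨m, m_one, m_nonneg, m_inv⟩ := hG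
  by_contra! hψ
  let translate (i : ι) : lp (fun _ : G => ℝ) ∞ :=
    ⟨fun h => ψ i (s i * h), memℓp_infty <| (lp.memℓp (ψ i)).bddAbove.mono <| by
      rintro _ ⟨h, rfl⟩
      exact ⟨s i * h, rfl⟩⟩
  have m_translate (i : ι) : m (translate i) = m (ψ i) :=
    m_inv (s i)⁻¹ (ψ i) (translate i) fun h => by simp [translate]
  have mean_nonneg : 0 ≤ m (∑ i, (translate i - ψ i) - c • 1) := m_nonneg _ fun h => by
    simp only [lp.coeFn_sub, lp.coeFn_sum, lp.coeFn_smul, lp.infty_coeFn_one, Pi.sub_apply,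
      Finset.sum_apply, Pi.smul_apply, Pi.one_apply, smul_eq_mul, mul_one]
    exact sub_nonneg.2 (hψ h)
  simp only [map_sub, map_sum, m_translate, sub_self, Finset.sum_const_zero, map_smul, m_one,
    smul_eq_mul, mul_one] at mean_nonneg
  linarith

-- Day's argument: a functional separating `0` from this convex set is a family of bounded
-- functions on `G` whose translates differ from it by a strictly positive amount everywhere.
theorem zero_mem_closure_translateSub (hG : IsAmenableGroup G) {ι : Type*} [Finite ι]
    (s : ι → G) : 0 ∈ closure (translateSub s '' finsuppSimplex G) := by
  classical
  have := Fintype.ofFinite ι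
  by_contra h0
  obtain ⟨f, c, hc, hf⟩ := geometric_hahn_banach_point_closed
    (convex_finsuppSimplex.linear_image (translateSub s)).closure isClosed_closure h0
  rw [map_zero] at hc
  choose ψ hψ using fun i => exists_bounded_eq_apply_single
    (f.comp (ContinuousLinearMap.single ℝ (fun _ : ι => lp (fun _ : G => ℝ) 1) i))
  obtain ⟨h, hlt⟩ := hG.exists_sum_translate_sub_lt s ψ hc
  refine hlt.not_gt ((hf _ (subset_closure
    ⟨_, single_one_mem_finsuppSimplex h, rfl⟩)).trans_eq ?_)
  rw [← Finset.univ_sum_single (translateSub s (Finsupp.single h 1)), map_sum]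
  simp [translateSub_single, hψ, Pi.single_sub]

/-- Reiter's condition. -/
theorem exists_tsum_abs_translate_sub_lt (hG : IsAmenableGroup G) (F : Finset G) {ε : ℝ}
    (hε : 0 < ε) :
    ∃ p ∈ finsuppSimplex G, ∀ g ∈ F, ∑' h, |p (g⁻¹ * h) - p h| < ε := by
  obtain ⟨_, ⟨p, hp, rfl⟩, hlt⟩ := Metric.mem_closure_iff.1
    (hG.zero_mem_closure_translateSub ((↑) : F → G)) ε hε
  rw [dist_zero_left] at hlt
  refine ⟨p, hp, fun g hg => ?_⟩
  have norm_eq := lp.norm_eq_tsum_rpow (p := 1) (by simp) (translateSub ((↑) : F → G) p ⟨g, hg⟩)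
  simp only [translateSub_apply, ENNReal.toReal_one, Real.rpow_one, div_one,
    Real.norm_eq_abs] at norm_eq
  exact norm_eq ▸ (norm_le_pi_norm _ _).trans_lt hlt

end IsAmenableGroup

theorem sq_sqrt_sub_sqrt_le_abs_sub {a b : ℝ} (ha : 0 ≤ a) (hb : 0 ≤ b) :
    (√a - √b) ^ 2 ≤ |a - b| := by
  have h : |√a - √b| ≤ √a + √b :=
    abs_le.2 ⟨by linarith [Real.sqrt_nonneg a], by linarith [Real.sqrt_nonneg b]⟩
  calc (√a - √b) ^ 2 = |√a - √b| * |√a - √b| := by rw [← sq, sq_abs]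
    _ ≤ (√a + √b) * |√a - √b| := by gcongr
    _ = |(√a + √b) * (√a - √b)| := by rw [abs_mul, abs_of_nonneg (a := √a + √b) (by positivity)]
    _ = |a - b| := by rw [← sq_sub_sq, Real.sq_sqrt ha, Real.sq_sqrt hb]

theorem UnitaryRep.regular_apply (g : G) (f : lp (fun _ : G => ℂ) 2) (h : G) :
    UnitaryRep.regular G g f h = f (g⁻¹ * h) := rfl

theorem IsAmenableGroup.exists_norm_regular_sub_lt (hG : IsAmenableGroup G) (F : Finset G) {ε : ℝ}
    (hε : 0 < ε) :
    ∃ ξ : G →₀ ℂ, ‖finsuppToLp ℂ 2 ξ‖ = 1 ∧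
      ∀ g ∈ F, ‖UnitaryRep.regular G g (finsuppToLp ℂ 2 ξ) - finsuppToLp ℂ 2 ξ‖ < ε := by
  obtain ⟨p, ⟨p_nonneg, p_total⟩, hF⟩ := hG.exists_tsum_abs_translate_sub_lt F (pow_pos hε 2)
  let ξ : G →₀ ℂ := p.mapRange (fun t => (√t : ℂ)) (by simp)
  have ξ_apply (h : G) : finsuppToLp ℂ 2 ξ h = (√(p h) : ℂ) := rfl
  refine ⟨ξ, ?_, fun g hg => lt_of_pow_lt_pow_left₀ 2 hε.le ?_⟩
  · rw [← sq_eq_sq₀ (norm_nonneg _) zero_le_one, lp_norm_sq_eq_tsum, one_pow, ← p_total,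
      Finsupp.sum, ← tsum_eq_sum (f := p) (L := .unconditional G)
        fun h hh => by simpa using hh]
    refine tsum_congr fun h => ?_
    rw [ξ_apply, Complex.norm_real, Real.norm_eq_abs, sq_abs, Real.sq_sqrt (p_nonneg h)]
  · have finite_support : (fun h => |p (g⁻¹ * h) - p h|).HasFiniteSupport := by
      have h1 : (fun h => p (g⁻¹ * h)).HasFiniteSupport :=
        p.hasFiniteSupport.preimage (mul_right_injective g⁻¹).injOn
      refine (h1.union p.hasFiniteSupport).subset fun h hh => ?_
      by_contra h0
      simp_all
    have pointwise (h : G) :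
        ‖(UnitaryRep.regular G g (finsuppToLp ℂ 2 ξ) - finsuppToLp ℂ 2 ξ) h‖ ^ 2 ≤
          |p (g⁻¹ * h) - p h| := by
      rw [lp.coeFn_sub, Pi.sub_apply, UnitaryRep.regular_apply, ξ_apply, ξ_apply,
        ← Complex.ofReal_sub, Complex.norm_real, Real.norm_eq_abs, sq_abs]
      exact sq_sqrt_sub_sqrt_le_abs_sub (p_nonneg _) (p_nonneg _)
    have summable : Summable fun h => |p (g⁻¹ * h) - p h| :=
      summable_of_hasFiniteSupport finite_support
    rw [lp_norm_sq_eq_tsum]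
    exact ((summable.of_nonneg_of_le (fun _ => sq_nonneg _) pointwise).tsum_le_tsum
      pointwise summable).trans_lt (hF g hg)

end Amenable

section Semantics

variable {G : Type u} [Group G] {H : Type v} [NormedAddCommGroup H] [InnerProductSpace ℂ H]
  {K : Type w} [NormedAddCommGroup K] [InnerProductSpace ℂ K]

namespace UnitaryRep

theorem mul_apply (π : UnitaryRep G H) (g h : G) (x : H) : π (g * h) x = π g (π h x) := by
  rw [map_mul]
  rfl

theorem inner_map_right (π : UnitaryRep G H) (g : G) (x y : H) :
    ⟪x, π g y⟫_ℂ = ⟪π g⁻¹ x, y⟫_ℂ := by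
  rw [← (π g).inner_map_map (π g⁻¹ x) y, ← π.mul_apply]
  simp

/-- The matrix coefficient `g ↦ ⟪π g x, y⟫` of a unitary representation. As a product over `G`,
the space of functions `G → ℂ` carries the topology of pointwise convergence. -/
noncomputable def matrixCoeff (π : UnitaryRep G H) (x y : H) : G → ℂ := fun g => ⟪π g x, y⟫_ℂ

theorem conj_matrixCoeff (π : UnitaryRep G H) (x y : H) (g : G) :
    starRingEnd ℂ (π.matrixCoeff x y g) = π.matrixCoeff y x g⁻¹ := by
  rw [matrixCoeff, matrixCoeff, inner_conj_symm, inner_map_right]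

/-- The Gram data of a family of vectors under a unitary representation: all matrix coefficients
between its members, that is, the Gram matrix of its translates. -/
noncomputable def gram {V : Type*} (π : UnitaryRep G H) (y : V → H) : V → V → G → ℂ :=
  fun i j => π.matrixCoeff (y i) (y j)

end UnitaryRep

variable {T : Type*} {l : Filter T} {σ : UnitaryRep G H} {η : UnitaryRep G K}

theorem tendsto_matrixCoeff_swap {y z : T → H} {Y Z : K}
    (h : Tendsto (fun t => σ.matrixCoeff (y t) (z t)) l (𝓝 (η.matrixCoeff Y Z))) :
    Tendsto (fun t => σ.matrixCoeff (z t) (y t)) l (𝓝 (η.matrixCoeff Z Y)) := by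
  rw [tendsto_pi_nhds] at h ⊢
  intro g
  simpa only [Function.comp_def, UnitaryRep.conj_matrixCoeff, inv_inv] using
    (Complex.continuous_conj.tendsto _).comp (h g⁻¹)

variable {V S : Type} {y : T → V → H} {Y : V → K} {a : S → ℂ}

/-- Convergence of the values of a term along a filter. The values of a vector term at the tuples
`y t` lie in a different space than its value at `Y`, so their convergence is tested by matrix
coefficients against those families `z` whose matrix coefficients against the variables
converge. -/
def RepTerm.EvalTendsto (l : Filter T) (σ : UnitaryRep G H) (η : UnitaryRep G K)
    (y : T → V → H) (Y : V → K) (a : S → ℂ) : ∀ {s : HSort}, RepTerm G V S s → Prop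
  | HSort.vec, s => ∀ (z : T → H) (Z : K),
      (∀ j, Tendsto (fun t => σ.matrixCoeff (z t) (y t j)) l (𝓝 (η.matrixCoeff Z (Y j)))) →
      Tendsto (fun t => σ.matrixCoeff (z t) (s.eval σ (y t) a)) l
        (𝓝 (η.matrixCoeff Z (s.eval η Y a)))
  | HSort.scal, c => Tendsto (fun t => (c.eval σ (y t) a).down) l (𝓝 (c.eval η Y a).down)

theorem RepTerm.evalTendsto (hy : Tendsto (fun t => σ.gram (y t)) l (𝓝 (η.gram Y)))
    {s : HSort} (t : RepTerm G V S s) : t.EvalTendsto l σ η y Y a := by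
  simp only [tendsto_pi_nhds, UnitaryRep.gram] at hy
  induction t with
  | vecVar x => exact fun z Z hz => hz x
  | zero =>
    refine fun z Z _ => tendsto_pi_nhds.2 fun g => ?_
    simpa only [RepTerm.eval, UnitaryRep.matrixCoeff, inner_zero_right] using tendsto_const_nhds
  | vecAdd s t hs ht =>
    refine fun z Z hz => tendsto_pi_nhds.2 fun g => ?_
    simpa only [RepTerm.eval, UnitaryRep.matrixCoeff, inner_add_right] using
      (tendsto_pi_nhds.1 (hs z Z hz) g).add (tendsto_pi_nhds.1 (ht z Z hz) g)
  | smul c s hc hs =>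
    refine fun z Z hz => tendsto_pi_nhds.2 fun g => ?_
    simpa only [RepTerm.eval, UnitaryRep.matrixCoeff, inner_smul_right] using
      Tendsto.mul hc (tendsto_pi_nhds.1 (hs z Z hz) g)
  | act h s hs =>
    refine fun z Z hz => tendsto_pi_nhds.2 fun g => ?_
    simpa only [RepTerm.eval, UnitaryRep.matrixCoeff, UnitaryRep.inner_map_right,
      UnitaryRep.mul_apply] using tendsto_pi_nhds.1 (hs z Z hz) (h⁻¹ * g)
  | scalVar i => exact tendsto_const_nhds
  | const q => exact tendsto_const_nhds
  | scalAdd c d hc hd => exact Tendsto.add hc hd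
  | mul c d hc hd => exact Tendsto.mul hc hd
  | conj c hc => exact (Complex.continuous_conj.tendsto _).comp hc
  | inner s t hs ht =>
    have s_vars (j : V) := tendsto_matrixCoeff_swap (hs _ _ fun i => tendsto_pi_nhds.2 (hy j i))
    have := tendsto_pi_nhds.1 (ht _ _ s_vars) 1
    simp only [UnitaryRep.matrixCoeff, map_one, LinearIsometryEquiv.coe_one, id_eq] at this
    exact this

theorem RealPart.continuous_eval (r : RealPart) : Continuous r.eval := by
  cases r
  · exact Complex.continuous_re
  · exact Complex.continuous_im
  · exact continuous_norm

theorem QFFormula.Approx.eventually_realize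
    (hy : Tendsto (fun t => σ.gram (y t)) l (𝓝 (η.gram Y)))
    {φ φ' : QFFormula G V S} (h : φ.Approx φ') (hφ : φ.Realize η Y a) :
    ∀ᶠ t in l, φ'.Realize σ (y t) a := by
  induction h with
  | le r c p ε hε =>
    have hc := (r.continuous_eval.tendsto _).comp (c.evalTendsto (a := a) hy)
    have hlt : r.eval (c.eval η Y a).down < ((p + ε : ℚ) : ℝ) :=
      lt_of_le_of_lt hφ (by exact_mod_cast lt_add_of_pos_right p hε)
    exact (hc.eventually_lt_const hlt).mono fun _ => le_of_lt
  | ge r c p ε hε =>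
    have hc := (r.continuous_eval.tendsto _).comp (c.evalTendsto (a := a) hy)
    have hlt : ((p - ε : ℚ) : ℝ) < r.eval (c.eval η Y a).down :=
      lt_of_lt_of_le (by exact_mod_cast sub_lt_self p hε) hφ
    exact (hc.eventually_const_lt hlt).mono fun _ => le_of_lt
  | and _ _ h₁ h₂ => exact (h₁ hφ.1).and (h₂ hφ.2)
  | or _ _ h₁ h₂ =>
    rcases hφ with hφ | hφ
    · exact (h₁ hφ).mono fun _ => Or.inl
    · exact (h₂ hφ).mono fun _ => Or.inr

theorem QFFormula.Approx.exists_realize_of_gram_mem_closure {s : Set (V → H)}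
    (hY : η.gram Y ∈ closure (σ.gram '' s)) {φ φ' : QFFormula G V S} (h : φ.Approx φ')
    (hφ : φ.Realize η Y a) : ∃ x ∈ s, φ'.Realize σ x a := by
  obtain ⟨U, hU, hU_realize⟩ :=
    mem_comap.1 (h.eventually_realize (σ := σ) (y := id) tendsto_comap hφ)
  obtain ⟨_, hxU, x, hx, rfl⟩ := mem_closure_iff_nhds.1 hY U hU
  exact ⟨x, hx, hU_realize hxU⟩

theorem UnitaryRep.ExistentiallyClosed.of_gram_mem_closure
    (hσ : ∀ (K : Type w) [NormedAddCommGroup K] [InnerProductSpace ℂ K] [CompleteSpace K]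
      (η : UnitaryRep G K) (ι : H →ₗᵢ[ℂ] K) (_ : ∀ g v, ι (σ g v) = η g (ι v))
      (m n : ℕ) (v : Fin n → H) (X : Fin m → K),
      η.gram (Sum.elim X fun i => ι (v i)) ∈
        closure (σ.gram '' Set.range fun x : Fin m → H => Sum.elim x v)) :
    UnitaryRep.ExistentiallyClosed.{u, v, w} σ := by
  intro K _ _ _ η ι hι m n k l v b φ φ' ⟨X, a, hφ⟩ happ
  obtain ⟨_, ⟨x, rfl⟩, hx⟩ :=
    happ.exists_realize_of_gram_mem_closure (hσ K η ι hι m n v X) hφ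
  exact ⟨x, a, hx⟩

end Semantics

section Hilbert

variable {𝕜 E F : Type*} [RCLike 𝕜] [NormedAddCommGroup E] [InnerProductSpace 𝕜 E]
  [NormedAddCommGroup F] [InnerProductSpace 𝕜 F]

theorem sum_inner_mul_inner_coe {W : Submodule 𝕜 E} {N : Type*} [Fintype N]
    (b : OrthonormalBasis N 𝕜 W) (x : E) {y : E} (hy : y ∈ W) :
    ∑ n, ⟪x, (b n : E)⟫_𝕜 * ⟪(b n : E), y⟫_𝕜 = ⟪x, y⟫_𝕜 := by
  have h := congrArg (fun w : W => ⟪x, (w : E)⟫_𝕜) (b.sum_repr' ⟨y, hy⟩)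
  simpa only [Submodule.coe_inner, Submodule.coe_sum, Submodule.coe_smul, inner_sum,
    inner_smul_right, mul_comm] using h

theorem inner_map_sub_map_adjoint [CompleteSpace E] [CompleteSpace F] (ι : E →ₗᵢ[𝕜] F) (x : E)
    (y : F) :
    ⟪ι x, y - ι (ι.toContinuousLinearMap.adjoint y)⟫_𝕜 = 0 := by
  rw [inner_sub_right, ι.inner_map_map, ContinuousLinearMap.adjoint_inner_right, sub_eq_zero]
  rfl

variable (𝕜 E F) in
/-- The inclusion of the second summand of a Hilbert space direct sum. -/
noncomputable def prodInr : F →ₗᵢ[𝕜] WithLp 2 (E × F) where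
  toLinearMap := (WithLp.linearEquiv 2 𝕜 (E × F)).symm.toLinearMap ∘ₗ LinearMap.inr 𝕜 E F
  norm_map' _ := WithLp.norm_toLp_snd ..

end Hilbert

section ShiftedCopies

variable {𝕜 E : Type*} [RCLike 𝕜] [NormedAddCommGroup E] [InnerProductSpace 𝕜 E] {N : ℕ}

variable (𝕜) in
/-- The embedding of `N` copies of `E` into the Hilbert sum of countably many copies as the copies
`M, …, M + N - 1`. -/
noncomputable def shiftedCopies (M : ℕ) : (Fin N → E) →ₗ[𝕜] lp (fun _ : ℕ => E) 2 :=
  ∑ n : Fin N, lp.lsingle 2 (M + (n : ℕ)) ∘ₗ LinearMap.proj n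

theorem shiftedCopies_eq_sum (M : ℕ) (z : Fin N → E) :
    shiftedCopies 𝕜 M z = ∑ n : Fin N, lp.single 2 (M + (n : ℕ)) (z n) := by
  simp [shiftedCopies]

theorem shiftedCopies_apply_add (M : ℕ) (z : Fin N → E) (n : Fin N) :
    shiftedCopies 𝕜 M z (M + (n : ℕ)) = z n := by
  rw [shiftedCopies_eq_sum, lp.coeFn_sum, Finset.sum_apply, Finset.sum_eq_single n]
  · exact lp.single_apply_self ..
  · intro k _ hk
    exact lp.single_apply_ne _ _ _ fun h => hk (Fin.ext (Nat.add_left_cancel h).symm)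
  · simp

theorem inner_shiftedCopies_left (M : ℕ) (z : Fin N → E) (f : lp (fun _ : ℕ => E) 2) :
    ⟪shiftedCopies 𝕜 M z, f⟫_𝕜 = ∑ n : Fin N, ⟪z n, f (M + (n : ℕ))⟫_𝕜 := by
  rw [shiftedCopies_eq_sum, sum_inner]
  exact Finset.sum_congr rfl fun n _ => lp.inner_single_left _ _ _

end ShiftedCopies

section WeaklyNull

variable {𝕜 T H : Type*} [RCLike 𝕜] {l : Filter T} [NormedAddCommGroup H] [InnerProductSpace 𝕜 H]

variable (𝕜 l) in
/-- Weak convergence to `0` along a filter, tested against the vectors of the space. -/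
def WeaklyNull (u : T → H) : Prop :=
  ∀ z, Tendsto (fun t => ⟪u t, z⟫_𝕜) l (𝓝 0)

theorem WeaklyNull.tendsto_inner_right {u : T → H} (hu : WeaklyNull 𝕜 l u) (z : H) :
    Tendsto (fun t => ⟪z, u t⟫_𝕜) l (𝓝 0) := by
  simpa only [Function.comp_def, inner_conj_symm, map_zero] using
    (RCLike.continuous_conj.tendsto _).comp (hu z)

theorem WeaklyNull.map {E : Type*} [NormedAddCommGroup E] [InnerProductSpace 𝕜 E]
    [CompleteSpace E] [CompleteSpace H] {u : T → E} (hu : WeaklyNull 𝕜 l u) (A : E →L[𝕜] H) :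
    WeaklyNull 𝕜 l fun t => A (u t) := fun z => by
  simpa only [ContinuousLinearMap.adjoint_inner_right] using hu (A.adjoint z)

theorem weaklyNull_shiftedCopies {N : ℕ} (z : Fin N → H) :
    WeaklyNull 𝕜 atTop fun M => shiftedCopies 𝕜 M z := fun f => by
  have tendsto_norm : Tendsto (fun k => ‖f k‖) atTop (𝓝 0) := by
    have h := ((lp.memℓp f).summable (by simp)).tendsto_atTop_zero
    simp only [ENNReal.toReal_ofNat, Real.rpow_ofNat] at h
    simpa using h.sqrt
  have tendsto_coord (n : Fin N) :
      Tendsto (fun M => ⟪z n, f (M + (n : ℕ))⟫_𝕜) atTop (𝓝 0) := by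
    refine squeeze_zero_norm (fun M => norm_inner_le_norm (z n) (f (M + n))) ?_
    simpa using (tendsto_norm.comp (tendsto_add_atTop_nat (n : ℕ))).const_mul ‖z n‖
  simpa only [inner_shiftedCopies_left, Finset.sum_const_zero] using
    tendsto_finsetSum Finset.univ fun n _ => tendsto_coord n

end WeaklyNull

section Absorption

variable {G : Type u} [Group G] {H : Type v} [NormedAddCommGroup H] [InnerProductSpace ℂ H]
  {K : Type w} [NormedAddCommGroup K] [InnerProductSpace ℂ K]

theorem UnitaryRep.norm_matrixCoeff_sub_one_le (π : UnitaryRep G K) {x : K} (hx : ‖x‖ = 1) (g : G) :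
    ‖π.matrixCoeff x x g - 1‖ ≤ ‖π g x - x‖ := by
  have h : π.matrixCoeff x x g - 1 = ⟪π g x - x, x⟫_ℂ := by
    rw [matrixCoeff, inner_sub_left, inner_self_eq_norm_sq_to_K, hx]
    simp
  simpa only [h, hx, mul_one] using norm_inner_le_norm (𝕜 := ℂ) (π g x - x) x

/-- The diagonal matrix coefficient of a finitely supported function in the regular
representation. -/
noncomputable def regularCoeff (ξ : G →₀ ℂ) : G → ℂ :=
  (UnitaryRep.regular G).matrixCoeff (finsuppToLp ℂ 2 ξ) (finsuppToLp ℂ 2 ξ)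

/-- The trivial representation is weakly contained in the regular representation (Hulanicki). -/
theorem IsAmenableGroup.one_mem_closure_range_regularCoeff (hG : IsAmenableGroup G) :
    (1 : G → ℂ) ∈ closure (Set.range (regularCoeff (G := G))) := by
  choose ξ ξ_norm hξ using fun t : Finset G × ℕ =>
    hG.exists_norm_regular_sub_lt t.1 (ε := 1 / ((t.2 : ℝ) + 1)) Nat.one_div_pos_of_nat
  classical
  refine mem_closure_of_tendsto (b := atTop) (f := fun t => regularCoeff (ξ t))
    (tendsto_pi_nhds.2 fun g => ?_) (.of_forall fun t => ⟨ξ t, rfl⟩)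
  rw [tendsto_iff_norm_sub_tendsto_zero]
  refine squeeze_zero' (.of_forall fun _ => norm_nonneg _) ?_
    (tendsto_one_div_add_atTop_nhds_zero_nat.comp
      (tendsto_snd.mono_left (prod_atTop_atTop_eq (α := Finset G) (β := ℕ)).ge))
  filter_upwards [eventually_ge_atTop (({g}, 0) : Finset G × ℕ)] with t ht
  exact ((UnitaryRep.regular G).norm_matrixCoeff_sub_one_le (ξ_norm t) g).trans
    (hξ t g (Finset.singleton_subset_iff.1 ht.1)).le

/-- The coordinate along `b` of Fell's embedding of `K` into `ℓ²(G) ⊗ K` given by `ξ`, which sends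
`x` to the function `h ↦ ξ h • η h⁻¹ x` and turns `η` into a multiple of the regular
representation. -/
noncomputable def fellCoordinate (η : UnitaryRep G K) (ξ : lp (fun _ : G => ℂ) 2) (b : K) :
    K →ₗ[ℂ] lp (fun _ : G => ℂ) 2 where
  toFun x := ⟨fun h => ξ h * ⟪b, η h⁻¹ x⟫_ℂ,
    ((lp.memℓp ξ).norm.const_mul (‖b‖ * ‖x‖)).mono fun h => by
      have := norm_inner_le_norm (𝕜 := ℂ) b (η h⁻¹ x)
      rw [LinearIsometryEquiv.norm_map] at this
      rw [norm_mul, mul_comm]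
      exact mul_le_mul_of_nonneg_right this (norm_nonneg (ξ h))⟩
  map_add' x y := by
    ext h
    change ξ h * ⟪b, η h⁻¹ (x + y)⟫_ℂ = ξ h * ⟪b, η h⁻¹ x⟫_ℂ + ξ h * ⟪b, η h⁻¹ y⟫_ℂ
    rw [map_add, inner_add_right, mul_add]
  map_smul' c x := by
    ext h
    simp [mul_left_comm]

theorem fellCoordinate_apply (η : UnitaryRep G K) (ξ : lp (fun _ : G => ℂ) 2) (b x : K) (h : G) :
    fellCoordinate η ξ b x h = ξ h * ⟪b, η h⁻¹ x⟫_ℂ := rfl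

theorem sum_matrixCoeff_fellCoordinate (η : UnitaryRep G K) (ξ : lp (fun _ : G => ℂ) 2)
    {W : Submodule ℂ K} {N : Type*} [Fintype N] (b : OrthonormalBasis N ℂ W) (x : K) {y : K}
    (hy : ∀ h, ξ h ≠ 0 → η h⁻¹ y ∈ W) :
    ∑ n, (UnitaryRep.regular G).matrixCoeff (fellCoordinate η ξ (b n) x)
        (fellCoordinate η ξ (b n) y) =
      (UnitaryRep.regular G).matrixCoeff ξ ξ * η.matrixCoeff x y := by
  ext g
  simp only [Finset.sum_apply, Pi.mul_apply, UnitaryRep.matrixCoeff, lp.inner_eq_tsum]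
  rw [← Summable.tsum_finsetSum fun n _ => lp.summable_inner _ _, ← tsum_mul_right]
  refine tsum_congr fun h => ?_
  have term (n : N) :
      ⟪UnitaryRep.regular G g (fellCoordinate η ξ (b n) x) h, fellCoordinate η ξ (b n) y h⟫_ℂ =
        ⟪UnitaryRep.regular G g ξ h, ξ h⟫_ℂ *
          (⟪η h⁻¹ (η g x), (b n : K)⟫_ℂ * ⟪(b n : K), η h⁻¹ y⟫_ℂ) := by
    have translate : η (g⁻¹ * h)⁻¹ x = η h⁻¹ (η g x) := by
      rw [mul_inv_rev, inv_inv, UnitaryRep.mul_apply]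
    simp only [UnitaryRep.regular_apply, fellCoordinate_apply, RCLike.inner_apply, translate,
      map_mul, inner_conj_symm]
    ring
  simp only [term, ← Finset.mul_sum]
  rcases eq_or_ne (ξ h) 0 with h0 | h0
  · simp only [h0, inner_zero_right, zero_mul]
  · rw [sum_inner_mul_inner_coe b _ (hy h h0), LinearIsometryEquiv.inner_map_map]

theorem UnitaryRep.infiniteSum_shiftedCopies (π : UnitaryRep G K) (g : G) {N : ℕ} (M : ℕ)
    (z : Fin N → K) :
    π.infiniteSum g (shiftedCopies ℂ M z) = shiftedCopies ℂ M fun n => π g (z n) := by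
  simp only [shiftedCopies_eq_sum, map_sum]
  refine Finset.sum_congr rfl fun n _ => ?_
  ext k
  change π g (lp.single (E := fun _ : ℕ => K) 2 (M + (n : ℕ)) (z n) k) =
    lp.single (E := fun _ : ℕ => K) 2 (M + (n : ℕ)) (π g (z n)) k
  rcases eq_or_ne k (M + n) with rfl | hk
  · simp only [lp.single_apply_self]
  · rw [lp.single_apply_ne _ _ _ hk, lp.single_apply_ne _ _ _ hk, map_zero]

theorem UnitaryRep.matrixCoeff_infiniteSum_shiftedCopies (π : UnitaryRep G K) {N : ℕ} (M : ℕ)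
    (z z' : Fin N → K) :
    π.infiniteSum.matrixCoeff (shiftedCopies ℂ M z) (shiftedCopies ℂ M z') =
      ∑ n, π.matrixCoeff (z n) (z' n) := by
  ext g
  simp only [matrixCoeff, infiniteSum_shiftedCopies, inner_shiftedCopies_left,
    shiftedCopies_apply_add, Finset.sum_apply]

theorem tendsto_matrixCoeff_add_of_weaklyNull (σ : UnitaryRep G H) {T : Type*} {l : Filter T}
    {u u' : T → H} (hu : WeaklyNull ℂ l u) (hu' : WeaklyNull ℂ l u') (p p' : H) {c : G → ℂ}
    (hc : ∀ t, σ.matrixCoeff (u t) (u' t) = c) :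
    Tendsto (fun t => σ.matrixCoeff (p + u t) (p' + u' t)) l (𝓝 (σ.matrixCoeff p p' + c)) := by
  refine tendsto_pi_nhds.2 fun g => ?_
  have expand (t : T) : σ.matrixCoeff (p + u t) (p' + u' t) g =
      σ.matrixCoeff p p' g + c g + ⟪σ g p, u' t⟫_ℂ + ⟪u t, σ g⁻¹ p'⟫_ℂ := by
    rw [← hc t, UnitaryRep.inner_map_right, inv_inv]
    simp only [UnitaryRep.matrixCoeff, map_add, inner_add_left, inner_add_right]
    ring
  simpa only [expand, Pi.add_apply, add_zero] using
    (tendsto_const_nhds.add (hu'.tendsto_inner_right (σ g p))).add (hu (σ g⁻¹ p'))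

theorem exists_weaklyNull_absorption (η : UnitaryRep G K) (ξ : G →₀ ℂ) {V : Type*} [Finite V]
    (Q : V → K) :
    ∃ S : ℕ → K →ₗ[ℂ] lp (fun _ : ℕ => lp (fun _ : G => ℂ) 2) 2,
      (∀ x, WeaklyNull ℂ atTop fun M => S M x) ∧
      ∀ M i j, (UnitaryRep.regular G).infiniteSum.matrixCoeff (S M (Q i)) (S M (Q j)) =
        regularCoeff ξ * η.matrixCoeff (Q i) (Q j) := by
  let W : Submodule ℂ K :=
    Submodule.span ℂ (Set.range fun hi : ξ.support × V => η (hi.1 : G)⁻¹ (Q hi.2))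
  have : FiniteDimensional ℂ W := FiniteDimensional.span_of_finite ℂ (Set.finite_range _)
  let b := stdOrthonormalBasis ℂ W
  have mem_W (j : V) (h : G) (hh : finsuppToLp ℂ 2 ξ h ≠ 0) : η h⁻¹ (Q j) ∈ W :=
    Submodule.subset_span ⟨(⟨h, Finsupp.mem_support_iff.2 hh⟩, j), rfl⟩
  refine ⟨fun M => shiftedCopies ℂ M ∘ₗ
    LinearMap.pi fun n => fellCoordinate η (finsuppToLp ℂ 2 ξ) (b n),
    fun x => weaklyNull_shiftedCopies _, fun M i j => ?_⟩
  exact (UnitaryRep.matrixCoeff_infiniteSum_shiftedCopies _ _ _ _).trans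
    (sum_matrixCoeff_fellCoordinate η _ b (Q i) (mem_W j))

theorem matrixCoeff_map_add_of_orthogonal {σ : UnitaryRep G H} {η : UnitaryRep G K}
    {ι : H →ₗᵢ[ℂ] K} (hι : ∀ g x, ι (σ g x) = η g (ι x)) (p p' : H) {q q' : K}
    (hq : ∀ x, ⟪ι x, q⟫_ℂ = 0) (hq' : ∀ x, ⟪ι x, q'⟫_ℂ = 0) :
    η.matrixCoeff (ι p + q) (ι p' + q') = σ.matrixCoeff p p' + η.matrixCoeff q q' := by
  ext g
  have translate_orthogonal : ⟪η g q, ι p'⟫_ℂ = 0 := by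
    rw [← inner_conj_symm, UnitaryRep.inner_map_right, ← hι, hq, map_zero]
  simp only [UnitaryRep.matrixCoeff, Pi.add_apply, map_add, inner_add_left, inner_add_right, ← hι,
    hq', translate_orthogonal, ι.inner_map_map, add_zero, zero_add]

theorem prodInr_map (π : UnitaryRep G H) (ρ : UnitaryRep G K) (g : G) (x : K) :
    prodInr ℂ H K (ρ g x) = π.prod ρ g (prodInr ℂ H K x) :=
  congrArg (WithLp.toLp 2) (Prod.ext (map_zero (π g)).symm rfl)

variable [CompleteSpace H] {σ : UnitaryRep G H}
  {J : lp (fun _ : ℕ => lp (fun _ : G => ℂ) 2) 2 →ₗᵢ[ℂ] H}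

theorem add_regularCoeff_mul_mem_closure_gram
    (hJ : ∀ g f, J ((UnitaryRep.regular G).infiniteSum g f) = σ g (J f)) (η : UnitaryRep G K)
    (ξ : G →₀ ℂ) {V : Type*} [Finite V] (P : V → H) (Q : V → K) :
    (fun i j => σ.matrixCoeff (P i) (P j) + regularCoeff ξ * η.matrixCoeff (Q i) (Q j)) ∈
      closure (σ.gram '' {y | ∀ i, Q i = 0 → y i = P i}) := by
  obtain ⟨S, S_null, S_coeff⟩ := exists_weaklyNull_absorption η ξ Q
  have JS_null (i : V) : WeaklyNull ℂ atTop fun M => J (S M (Q i)) :=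
    (S_null (Q i)).map J.toContinuousLinearMap
  have JS_coeff (i j : V) (M : ℕ) : σ.matrixCoeff (J (S M (Q i))) (J (S M (Q j))) =
      regularCoeff ξ * η.matrixCoeff (Q i) (Q j) := by
    rw [← S_coeff M]
    ext g
    rw [UnitaryRep.matrixCoeff, ← hJ, J.inner_map_map, UnitaryRep.matrixCoeff]
  refine mem_closure_of_tendsto (b := atTop)
    (f := fun M => σ.gram fun i => P i + J (S M (Q i)))
    (tendsto_pi_nhds.2 fun i => tendsto_pi_nhds.2 fun j =>
      tendsto_matrixCoeff_add_of_weaklyNull σ (JS_null i) (JS_null j) (P i) (P j) (JS_coeff i j))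
    (.of_forall fun M => ⟨_, fun i hi => ?_, rfl⟩)
  simp only [hi, map_zero, add_zero]

theorem IsAmenableGroup.add_mem_closure_gram (hG : IsAmenableGroup G)
    (hJ : ∀ g f, J ((UnitaryRep.regular G).infiniteSum g f) = σ g (J f)) (η : UnitaryRep G K)
    {V : Type*} [Finite V] (P : V → H) (Q : V → K) :
    (fun i j => σ.matrixCoeff (P i) (P j) + η.matrixCoeff (Q i) (Q j)) ∈
      closure (σ.gram '' {y | ∀ i, Q i = 0 → y i = P i}) := by
  have continuous_add_mul : Continuous fun (c : G → ℂ) (i j : V) =>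
      σ.matrixCoeff (P i) (P j) + c * η.matrixCoeff (Q i) (Q j) := by
    fun_prop
  have h := map_mem_closure continuous_add_mul hG.one_mem_closure_range_regularCoeff
    (Set.mapsTo_range_iff.2 fun ξ => add_regularCoeff_mul_mem_closure_gram hJ η ξ P Q)
  simpa only [one_mul, closure_closure] using h

end Absorption

theorem mainTheorem1_general {G : Type u} [Group G] (hG : IsAmenableGroup G) {H : Type v}
    [NormedAddCommGroup H] [InnerProductSpace ℂ H] [CompleteSpace H] (σ : UnitaryRep G H)
    (J : lp (fun _ : ℕ => lp (fun _ : G => ℂ) 2) 2 →ₗᵢ[ℂ] H)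
    (hJ : ∀ g f, J ((UnitaryRep.regular G).infiniteSum g f) = σ g (J f)) :
    UnitaryRep.ExistentiallyClosed.{u, v, w} σ := by
  refine .of_gram_mem_closure fun K _ _ _ η ι hι m n v X => ?_
  let Y : Fin m ⊕ Fin n → K := Sum.elim X fun i => ι (v i)
  let P (i : Fin m ⊕ Fin n) : H := ι.toContinuousLinearMap.adjoint (Y i)
  let Q (i : Fin m ⊕ Fin n) : K := Y i - ι (P i)
  have gram_eq : η.gram Y = fun i j => σ.matrixCoeff (P i) (P j) + η.matrixCoeff (Q i) (Q j) := by
    funext i j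
    rw [← matrixCoeff_map_add_of_orthogonal hι _ _ (inner_map_sub_map_adjoint ι · (Y i))
      (inner_map_sub_map_adjoint ι · (Y j)), add_sub_cancel, add_sub_cancel]
    rfl
  have P_param (i : Fin n) : P (Sum.inr i) = v i :=
    DFunLike.congr_fun ι.adjoint_comp_self (v i)
  have Q_param (i : Fin n) : Q (Sum.inr i) = 0 := by simp [Q, P_param, Y]
  refine closure_mono (Set.image_mono fun y hy => ?_) (gram_eq ▸ hG.add_mem_closure_gram hJ η P Q)
  refine ⟨y ∘ Sum.inl, ?_⟩
  rw [← Sum.elim_comp_inl_inr y]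
  exact congrArg _ (funext fun i => ((hy _ (Q_param i)).trans (P_param i)).symm)

theorem mainTheorem1 (G : Type u) [Group G] [Countable G] (hG : IsAmenableGroup G) :
    (∀ (H : Type v) [NormedAddCommGroup H] [InnerProductSpace ℂ H] [CompleteSpace H]
      (π : UnitaryRep G H),
      UnitaryRep.ExistentiallyClosed.{u, max u v, w}
        (π.prod (UnitaryRep.regular G).infiniteSum)) ∧
    UnitaryRep.ExistentiallyClosed.{u, u, w} (UnitaryRep.regular G).infiniteSum :=
  ⟨fun _ _ _ _ π => mainTheorem1_general hG _ (prodInr ℂ _ _) (prodInr_map π _),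
    mainTheorem1_general hG _ .id fun _ _ => rfl⟩
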